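/- Let $a,b,n$ be integers with $n\ge 2$ and $2\le b\le a-2\le \frac{n}{2\ln n}$. A hypergraph $H=(V,E)$ consists of a set $V$ of vertices and a set $E=E(H)$ of subsets of $V$, called edges; it is $n$-uniform if every edge contains exactly $n$ vertices. An $(a:b)$-fractional coloring of $H$ assigns to every vertex a set of exactly $b$ distinct colors from a fixed set of $a$ colors; an edge is properly colored if no single color is assigned to all of its vertices. The hypergraph $H$ is $(a:b)$-colorable if it has an $(a:b)$-fractional coloring in which every edge is properly colored. Then every $n$-uniform hypergraph $H$ with $$|E(H)|\le (ab^3)^{-1/2}\left(\frac{n}{\ln n}\right)^{1/2}\left(\frac{a}{b}\right)^{n-1}$$ is $(a:b)$-colorable. -/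

import Mathlib

/-- A hypergraph is `n`-uniform if every edge contains exactly `n` vertices. -/
def Hypergraph.IsUniform {α : Type*} (H : Hypergraph α) (n : ℕ) : Prop :=
  ∀ e ∈ H.edgeSet, e.encard = n

/-- An `(a:b)`-fractional coloring of `H`: every vertex of `H` receives exactly `b` distinct colors
from a set of `a` colors. (Values outside the vertex set are irrelevant.) -/
def Hypergraph.IsFractionalColoring {α : Type*} (H : Hypergraph α) (a b : ℕ)
    (c : α → Finset (Fin a)) : Prop :=
  ∀ v ∈ H.vertexSet, (c v).card = b

/-- An edge `e` is properly colored by `c` if no single color appears at all vertices of `e`. -/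
def IsProperlyColoredEdge {α : Type*} {a : ℕ} (c : α → Finset (Fin a)) (e : Set α) : Prop :=
  ¬ ∃ γ : Fin a, ∀ v ∈ e, γ ∈ c v

/-- `H` is `(a:b)`-colorable if it has an `(a:b)`-fractional coloring in which every edge is
properly colored. -/
def Hypergraph.FractionallyColorable {α : Type*} (H : Hypergraph α) (a b : ℕ) : Prop :=
  ∃ c : α → Finset (Fin a), H.IsFractionalColoring a b c ∧
    ∀ e ∈ H.edgeSet, IsProperlyColoredEdge c e

open Finset

/-! Random recoloring. Every vertex independently draws a `b`-set of colors, a substitute color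
outside it and a weight below `N = 4n`. When an edge initially shares a color, its first vertex (by
weight, ties broken by a fixed order) gives up one such color for its substitute. By
`exists_coloring_of_no_conflict`, failure forces a conflict: edges `e`, `f` meeting at `v` and
colors `γ ≠ γ'`, with `e` initially sharing `γ`, `v` first in `e`, and `f` sharing `γ'` afterwards.
For fixed data, conflict conditions act on each vertex separately, so their probability is bounded
by a product (`prod_card_conflictStates_le`). With `j = |e ∩ f|`, the sum over `v` is controlled by
`j r^(j-1) ≤ 1/(1-r)`, and the sum over weights has order `N/n` (`sum_weight_pow_le`). The union
bound over all data is then below 1. -/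

/-! ### Counting color sets and substitutes -/

/-- Pairs of a `b`-element set of colors and a substitute color outside of it. -/
def colorPairs (a b : ℕ) : Finset (Finset (Fin a) × Fin a) :=
  (powersetCard b univ ×ˢ univ).filter fun p => p.2 ∉ p.1

lemma mem_colorPairs {a b : ℕ} {p : Finset (Fin a) × Fin a} :
    p ∈ colorPairs a b ↔ p.1.card = b ∧ p.2 ∉ p.1 := by
  simp [colorPairs, mem_powersetCard]

lemma card_filter_colorPairs {a b : ℕ} (Q : Finset (Fin a) → Prop) [DecidablePred Q] :
    ((colorPairs a b).filter fun p => Q p.1).card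
      = ((powersetCard b univ).filter Q).card * (a - b) := by
  have h : (colorPairs a b).filter (fun p => Q p.1)
      = (((powersetCard b univ).filter Q).sigma fun C => Cᶜ).map
        (Equiv.sigmaEquivProd _ _).toEmbedding := by
    ext ⟨C, s⟩
    simp [mem_colorPairs, mem_powersetCard]
    tauto
  rw [h, card_map, card_sigma, sum_const_nat (m := a - b)]
  intro C hC
  simp only [mem_filter, mem_powersetCard] at hC
  rw [card_compl, hC.1.2, Fintype.card_fin]

lemma card_filter_colorPairs_substitute {a b : ℕ} (Q : Finset (Fin a) → Prop) [DecidablePred Q]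
    (γ : Fin a) :
    ((colorPairs a b).filter fun p => Q p.1 ∧ p.2 = γ).card
      = ((powersetCard b univ).filter fun C => Q C ∧ γ ∉ C).card := by
  have h : (colorPairs a b).filter (fun p => Q p.1 ∧ p.2 = γ)
      = ((powersetCard b univ).filter fun C => Q C ∧ γ ∉ C).map
        ⟨fun C => (C, γ), fun _ _ h => (Prod.ext_iff.1 h).1⟩ := by
    ext ⟨C, s⟩
    simp only [mem_filter, mem_colorPairs, mem_map, mem_powersetCard, subset_univ, true_and]
    constructor
    · rintro ⟨⟨h1, h2⟩, h3, rfl⟩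
      exact ⟨C, ⟨h1, h3, h2⟩, rfl⟩
    · rintro ⟨C', ⟨h1, h3, h2⟩, h⟩
      obtain ⟨rfl, rfl⟩ := Prod.ext_iff.1 h
      exact ⟨⟨h1, h2⟩, h3, rfl⟩
  rw [h, card_map]

lemma cast_choose_pred {a b : ℕ} (ha : 1 ≤ a) (hb : b ≤ a) :
    ((a - 1).choose b : ℝ) * a = a.choose b * (a - b) := by
  obtain ⟨m, rfl⟩ : ∃ m, a = m + 1 := ⟨a - 1, by omega⟩
  have h := Nat.choose_mul_succ_eq m b
  have h' : ((m.choose b * (m + 1) : ℕ) : ℝ) = ((m + 1).choose b * (m + 1 - b) : ℕ) := by rw [h]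
  push_cast [Nat.cast_sub hb] at h'
  simpa using h'

lemma card_powersetCard_notMem {a b : ℕ} (hb : b ≤ a) (γ : Fin a) :
    (((powersetCard b univ).filter fun C : Finset (Fin a) => γ ∉ C).card : ℝ) * a
      = a.choose b * (a - b) := by
  have h : (powersetCard b univ).filter (fun C : Finset (Fin a) => γ ∉ C)
      = powersetCard b (univ.erase γ) := by
    ext C
    simp only [mem_filter, mem_powersetCard, subset_erase, subset_univ, true_and]
    tauto
  rw [h, card_powersetCard, card_erase_of_mem (mem_univ _), card_univ, Fintype.card_fin]
  exact cast_choose_pred (by have := γ.2; omega) hb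

lemma card_powersetCard_notMem_notMem {a b : ℕ} (hb : b + 1 ≤ a) {γ γ' : Fin a} (hγ : γ ≠ γ') :
    (((powersetCard b univ).filter fun C : Finset (Fin a) => γ ∉ C ∧ γ' ∉ C).card : ℝ)
      * (a * (a - 1)) = a.choose b * (a - b) * (a - b - 1) := by
  have h : (powersetCard b univ).filter (fun C : Finset (Fin a) => γ ∉ C ∧ γ' ∉ C)
      = powersetCard b ((univ.erase γ).erase γ') := by
    ext C
    simp only [mem_filter, mem_powersetCard, subset_erase, subset_univ, true_and]
    tauto
  have ha : 2 ≤ a := by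
    have h1 := γ.2
    have h2 := γ'.2
    have h3 : γ.1 ≠ γ'.1 := fun h => hγ (Fin.ext h)
    omega
  rw [h, card_powersetCard, card_erase_of_mem (by simp [hγ.symm]),
    card_erase_of_mem (mem_univ _), card_univ, Fintype.card_fin]
  have h1 := cast_choose_pred (a := a) (b := b) (by omega) (by omega)
  have h2 := cast_choose_pred (a := a - 1) (b := b) (by omega) (by omega)
  rw [Nat.cast_sub (by omega : 1 ≤ a)] at h2
  push_cast at h2
  linear_combination a * h2 + (a - 1 - b : ℝ) * h1

lemma card_colorPairs {a b : ℕ} : (colorPairs a b).card = a.choose b * (a - b) := by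
  have := card_filter_colorPairs (a := a) (b := b) fun _ => True
  simpa using this

lemma card_powersetCard_mem {a b : ℕ} (hb : b ≤ a) (γ : Fin a) :
    (((powersetCard b univ).filter fun C : Finset (Fin a) => γ ∈ C).card : ℝ) * a
      = a.choose b * b := by
  have h1 := card_powersetCard_notMem hb γ
  have h2 := card_filter_add_card_filter_not (s := powersetCard b univ)
    (fun C : Finset (Fin a) => γ ∈ C)
  have h3 := congrArg (Nat.cast : ℕ → ℝ) h2
  rw [card_powersetCard, card_univ, Fintype.card_fin] at h3
  push_cast at h3
  linear_combination a * h3 - h1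

lemma card_powersetCard_mem_notMem {a b : ℕ} (hb : b + 1 ≤ a) {γ γ' : Fin a} (hγ : γ ≠ γ') :
    (((powersetCard b univ).filter fun C : Finset (Fin a) => γ ∈ C ∧ γ' ∉ C).card : ℝ)
      * (a * (a - 1)) = a.choose b * b * (a - b) := by
  have h1 := card_powersetCard_notMem (by omega : b ≤ a) γ'
  have h0 := card_powersetCard_notMem_notMem hb hγ
  have h2 := card_filter_add_card_filter_not
    (s := (powersetCard b univ).filter fun C : Finset (Fin a) => γ' ∉ C)
    (fun C : Finset (Fin a) => γ ∈ C)
  simp only [filter_filter, and_comm (a := γ' ∉ _)] at h2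
  have h3 := congrArg (Nat.cast : ℕ → ℝ) h2
  push_cast at h3
  linear_combination a * (a - 1) * h3 - h0 + (a - 1 : ℝ) * h1

lemma card_powersetCard_mem_mem {a b : ℕ} (hb : b + 1 ≤ a) {γ γ' : Fin a} (hγ : γ ≠ γ') :
    (((powersetCard b univ).filter fun C : Finset (Fin a) => γ ∈ C ∧ γ' ∈ C).card : ℝ)
      * (a * (a - 1)) = a.choose b * b * (b - 1) := by
  have h1 := card_powersetCard_mem (by omega : b ≤ a) γ
  have h0 := card_powersetCard_mem_notMem hb hγ
  have h2 := card_filter_add_card_filter_not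
    (s := (powersetCard b univ).filter fun C : Finset (Fin a) => γ ∈ C)
    (fun C : Finset (Fin a) => γ' ∈ C)
  simp only [filter_filter] at h2
  have h3 := congrArg (Nat.cast : ℕ → ℝ) h2
  push_cast at h3
  linear_combination a * (a - 1) * h3 - h0 + (a - 1 : ℝ) * h1

lemma card_colorPairs_mem {a b : ℕ} (hb : b + 1 ≤ a) (γ : Fin a) :
    (((colorPairs a b).filter fun p => γ ∈ p.1).card : ℝ)
      = (colorPairs a b).card * (b / a) := by
  have ha : (a : ℝ) ≠ 0 := Nat.cast_ne_zero.2 (by have := γ.2; omega)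
  rw [card_filter_colorPairs (fun C => γ ∈ C), card_colorPairs]
  have h := card_powersetCard_mem (by omega : b ≤ a) γ
  push_cast [Nat.cast_sub (show b ≤ a by omega)]
  field_simp
  linear_combination (a - b : ℝ) * h

lemma sub_one_ne_zero_of_ne {a : ℕ} {γ γ' : Fin a} (hγ : γ ≠ γ') : (a : ℝ) - 1 ≠ 0 := by
  have h1 := γ.2
  have h2 := γ'.2
  have h3 : γ.1 ≠ γ'.1 := fun h => hγ (Fin.ext h)
  have : (2 : ℝ) ≤ a := by exact_mod_cast (by omega : 2 ≤ a)
  linarith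

lemma card_colorPairs_mem_mem {a b : ℕ} (hb : b + 1 ≤ a) {γ γ' : Fin a} (hγ : γ ≠ γ') :
    (((colorPairs a b).filter fun p => γ ∈ p.1 ∧ γ' ∈ p.1).card : ℝ)
      = (colorPairs a b).card * (b * (b - 1) / (a * (a - 1))) := by
  have ha : (a : ℝ) ≠ 0 := Nat.cast_ne_zero.2 (by have := γ.2; omega)
  have ha' := sub_one_ne_zero_of_ne hγ
  rw [card_filter_colorPairs (fun C => γ ∈ C ∧ γ' ∈ C), card_colorPairs]
  have h := card_powersetCard_mem_mem hb hγ
  push_cast [Nat.cast_sub (show b ≤ a by omega)]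
  field_simp
  linear_combination (a - b : ℝ) * h

lemma card_colorPairs_substitute {a b : ℕ} (hb : b + 1 ≤ a) (γ : Fin a) :
    (((colorPairs a b).filter fun p => p.2 = γ).card : ℝ)
      = (colorPairs a b).card * (1 / a) := by
  have ha : (a : ℝ) ≠ 0 := Nat.cast_ne_zero.2 (by have := γ.2; omega)
  have h0 := card_filter_colorPairs_substitute (b := b) (fun _ => True) γ
  simp only [true_and] at h0
  rw [h0, card_colorPairs]
  have h := card_powersetCard_notMem (by omega : b ≤ a) γ
  push_cast [Nat.cast_sub (show b ≤ a by omega)]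
  field_simp
  linear_combination h

lemma card_colorPairs_mem_substitute {a b : ℕ} (hb : b + 1 ≤ a) {γ γ' : Fin a} (hγ : γ ≠ γ') :
    (((colorPairs a b).filter fun p => γ ∈ p.1 ∧ p.2 = γ').card : ℝ)
      = (colorPairs a b).card * (b / (a * (a - 1))) := by
  have ha : (a : ℝ) ≠ 0 := Nat.cast_ne_zero.2 (by have := γ.2; omega)
  have ha' := sub_one_ne_zero_of_ne hγ
  rw [card_filter_colorPairs_substitute (fun C => γ ∈ C), card_colorPairs]
  have h := card_powersetCard_mem_notMem hb hγ
  push_cast [Nat.cast_sub (show b ≤ a by omega)]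
  field_simp
  linear_combination h

/-! ### Vertex states and local conflict probabilities -/

/-- The states of a vertex: a set of `b` colors, a substitute color, and a weight below `N`. -/
def vertexStates (a b N : ℕ) : Finset ((Finset (Fin a) × Fin a) × ℕ) :=
  colorPairs a b ×ˢ range N

/-- The states a vertex `w` may have when `e` initially shares `γ`, `v` of weight `t` is the first
vertex of `e`, and `f` shares `γ'` after the recoloring, `v` being the last recolored vertex
of `f`, or else the first vertex of `f`. -/
def conflictStates {V : Type*} [DecidableEq V] (a b N : ℕ) (e f : Finset V) (v : V)
    (γ γ' : Fin a) (t : ℕ) (w : V) : Finset ((Finset (Fin a) × Fin a) × ℕ) :=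
  (vertexStates a b N).filter fun x =>
    if w = v then (γ ∈ x.1.1 ∧ (γ' ∈ x.1.1 ∨ x.1.2 = γ')) ∧ x.2 = t
    else (w ∈ e → γ ∈ x.1.1 ∧ t ≤ x.2) ∧ (w ∈ f → γ' ∈ x.1.1 ∨ (x.1.2 = γ' ∧ x.2 ≤ t)) ∧
      (w ∈ e → w ∈ f → γ' ∈ x.1.1)

lemma card_filter_vertexStates {a b N : ℕ} (Q : Finset (Fin a) × Fin a → Prop) (R : ℕ → Prop)
    [DecidablePred Q] [DecidablePred R] :
    ((vertexStates a b N).filter fun x => Q x.1 ∧ R x.2).card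
      = ((colorPairs a b).filter Q).card * ((range N).filter R).card := by
  rw [vertexStates, ← card_product, filter_product]

lemma card_vertexStates {a b N : ℕ} :
    (vertexStates a b N).card = (colorPairs a b).card * N := by
  rw [vertexStates, card_product, card_range]

section
variable {V : Type*} [DecidableEq V] {a b N : ℕ} {e f : Finset V} {v w : V} {γ γ' : Fin a} {t : ℕ}

lemma card_conflictStates_self (hb : b + 1 ≤ a) (hγ : γ ≠ γ') (ht : t < N) :
    ((conflictStates a b N e f v γ γ' t v).card : ℝ)
      ≤ (vertexStates a b N).card * (b ^ 2 / (a * (a - 1)) / N) := by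
  have hN : (N : ℝ) ≠ 0 := Nat.cast_ne_zero.2 (by omega)
  have ha : (a : ℝ) ≠ 0 := Nat.cast_ne_zero.2 (by have := γ.2; omega)
  have ha' := sub_one_ne_zero_of_ne hγ
  simp only [conflictStates, if_true]
  rw [card_filter_vertexStates (fun p => γ ∈ p.1 ∧ (γ' ∈ p.1 ∨ p.2 = γ')) (fun x => x = t)]
  have h1 : ((range N).filter fun x => x = t).card = 1 := by
    rw [card_eq_one]
    refine ⟨t, ?_⟩
    ext x
    simp only [mem_filter, mem_range, mem_singleton]
    omega
  have h2 : (((colorPairs a b).filter fun p => γ ∈ p.1 ∧ (γ' ∈ p.1 ∨ p.2 = γ')).card : ℝ)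
      ≤ (colorPairs a b).card * (b * (b - 1) / (a * (a - 1)))
        + (colorPairs a b).card * (b / (a * (a - 1))) := by
    rw [← card_colorPairs_mem_mem hb hγ, ← card_colorPairs_mem_substitute hb hγ]
    simp only [and_or_left, filter_or]
    exact_mod_cast card_union_le _ _
  rw [h1, card_vertexStates]
  push_cast
  rw [mul_one]
  refine h2.trans (le_of_eq ?_)
  field_simp
  ring

lemma card_range_filter_le (ht : t < N) :
    (((range N).filter fun x => t ≤ x).card : ℝ) = N * (1 - t / N) := by
  have hN : (N : ℝ) ≠ 0 := Nat.cast_ne_zero.2 (by omega)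
  have : (range N).filter (fun x => t ≤ x) = Ico t N := by
    ext x
    simp only [mem_filter, mem_range, mem_Ico]
    omega
  rw [this, Nat.card_Ico, Nat.cast_sub ht.le]
  field_simp

lemma card_range_filter_ge (ht : t < N) :
    (((range N).filter fun x => x ≤ t).card : ℝ) = t + 1 := by
  have : (range N).filter (fun x => x ≤ t) = range (t + 1) := by
    ext x
    simp only [mem_filter, mem_range]
    omega
  rw [this, card_range]
  push_cast
  rfl

/-- The factors are split so that the product over `w` separates into powers indexed by `e`, `f` and
`e ∩ f`. On `e ∩ f` the last factor corrects `(b/a)^2` to the probability of containing both colors;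
the factor `1 + (t + 1) / (N * b)` is mere slack there. -/
lemma card_conflictStates_of_ne (hb2 : 2 ≤ b) (hb : b + 1 ≤ a) (hγ : γ ≠ γ') (ht : t < N)
    (hw : w ≠ v) :
    ((conflictStates a b N e f v γ γ' t w).card : ℝ)
      ≤ (vertexStates a b N).card * ((if w ∈ e then (b / a : ℝ) * (1 - t / N) else 1) *
        (if w ∈ f then (b / a : ℝ) * (1 + (t + 1) / (N * b)) else 1) *
        (if w ∈ e ∩ f then (b - 1) * a / (b * (a - 1) : ℝ) else 1)) := by
  have hN : (0 : ℝ) < N := by exact_mod_cast (by omega : 0 < N)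
  have hb0 : (2 : ℝ) ≤ b := by exact_mod_cast hb2
  have ha0 : (b : ℝ) + 1 ≤ a := by exact_mod_cast hb
  have ha1 : (0 : ℝ) < a - 1 := by linarith
  have ha2 : (0 : ℝ) < a := by linarith
  have htN : (t : ℝ) / N ≤ 1 := by
    rw [div_le_one hN]
    exact_mod_cast ht.le
  simp only [conflictStates, if_neg hw, mem_inter]
  by_cases he : w ∈ e <;> by_cases hf : w ∈ f
  · simp only [he, hf, if_true, true_imp_iff, and_self]
    calc _ ≤ (((vertexStates a b N).filter
          fun x => (γ ∈ x.1.1 ∧ γ' ∈ x.1.1) ∧ t ≤ x.2).card : ℝ) := by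
          norm_cast
          refine card_le_card fun x => ?_
          simp only [mem_filter]
          tauto
      _ = (vertexStates a b N).card * ((b * (b - 1) / (a * (a - 1))) * (1 - t / N)) := by
          rw [card_filter_vertexStates (fun p => γ ∈ p.1 ∧ γ' ∈ p.1) (fun x => t ≤ x)]
          push_cast
          rw [card_colorPairs_mem_mem hb hγ, card_range_filter_le ht, card_vertexStates]
          push_cast
          ring
      _ ≤ _ := by
          refine mul_le_mul_of_nonneg_left ?_ (Nat.cast_nonneg _)
          have h1 : (0 : ℝ) ≤ (b * (b - 1) / (a * (a - 1))) :=
            div_nonneg (mul_nonneg (by linarith) (by linarith)) (by positivity)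
          have h2 : (0 : ℝ) ≤ (t + 1) / (N * b) := by positivity
          refine (le_mul_of_one_le_right (mul_nonneg h1 (by linarith))
            (by linarith : 1 ≤ 1 + ((t : ℝ) + 1) / (N * b))).trans (le_of_eq ?_)
          field_simp
  · simp only [he, hf, if_true, if_false, true_imp_iff, false_imp_iff, and_true, and_false,
      mul_one]
    rw [card_filter_vertexStates (fun p => γ ∈ p.1) (fun x => t ≤ x)]
    push_cast
    rw [card_colorPairs_mem hb, card_range_filter_le ht, card_vertexStates]
    push_cast
    apply le_of_eq
    ring
  · simp only [he, hf, if_true, if_false, true_imp_iff, false_imp_iff, and_true, true_and,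
      mul_one, one_mul]
    calc _ ≤ (((vertexStates a b N).filter fun x => γ' ∈ x.1.1 ∧ True).card : ℝ) +
          ((vertexStates a b N).filter fun x => x.1.2 = γ' ∧ x.2 ≤ t).card := by
          rw [filter_or]
          simp only [and_true]
          exact_mod_cast card_union_le _ _
      _ = _ := by
          rw [card_filter_vertexStates (fun p => γ' ∈ p.1) (fun _ => True),
            card_filter_vertexStates (fun p => p.2 = γ') (fun x => x ≤ t)]
          push_cast
          rw [card_colorPairs_mem hb, card_colorPairs_substitute hb, card_range_filter_ge ht,
            card_vertexStates, filter_true, card_range]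
          push_cast
          field_simp
  · simp only [he, hf, if_false, false_imp_iff, and_true, false_and, filter_true, mul_one]
    exact le_rfl

end

/-! ### The recoloring argument -/

lemma exists_coloring_of_no_conflict {V : Type*} [LinearOrder V] {a b N : ℕ}
    {E : Finset (Finset V)} (hE : ∀ e ∈ E, e.Nonempty)
    {ω : V → (Finset (Fin a) × Fin a) × ℕ} (hω : ∀ v, ω v ∈ vertexStates a b N)
    (h : ∀ e ∈ E, ∀ f ∈ E, ∀ v ∈ e ∩ f, ∀ γ γ', γ ≠ γ' → ∀ t < N,
      ∃ w, ω w ∉ conflictStates a b N e f v γ γ' t w) :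
    ∃ c : V → Finset (Fin a), (∀ v, (c v).card = b) ∧ ∀ e ∈ E, ∀ γ, ∃ v ∈ e, γ ∉ c v := by
  classical
  -- Breaking ties makes `R` injective, so first and last vertices are unique even when weights
  -- coincide.
  let R : V → ℕ ×ₗ V := fun v => toLex ((ω v).2, v)
  have hR : ∀ {v w}, R v ≤ R w → (ω v).2 ≤ (ω w).2 := fun {v w} hvw => by
    rcases (Prod.Lex.le_iff).1 hvw with h | h
    · exact h.le
    · exact h.1.le
  have hRinj : ∀ {v w}, R v ≤ R w → R w ≤ R v → w = v := fun {v w} h1 h2 =>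
    (Prod.ext_iff.1 (toLex.injective (le_antisymm h2 h1))).2
  have hst : ∀ v, (ω v).1.1.card = b ∧ (ω v).1.2 ∉ (ω v).1.1 ∧ (ω v).2 < N := fun v => by
    have := hω v
    rw [vertexStates, mem_product, mem_colorPairs, mem_range] at this
    exact ⟨this.1.1, this.1.2, this.2⟩
  let B : V → Fin a → Prop := fun v γ =>
    ∃ e ∈ E, v ∈ e ∧ (∀ w ∈ e, R v ≤ R w) ∧ ∀ w ∈ e, γ ∈ (ω w).1.1
  -- A vertex is recolored at most once, even if it is first in several edges sharing different
  -- colors.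
  let c : V → Finset (Fin a) := fun v =>
    if hv : ∃ γ, B v γ then insert (ω v).1.2 ((ω v).1.1.erase hv.choose) else (ω v).1.1
  have hc : ∀ v γ, γ ∈ c v → γ ∉ (ω v).1.1 → γ = (ω v).1.2 ∧ ∃ γ₀, B v γ₀ := fun v γ h1 h2 => by
    by_cases hv : ∃ γ, B v γ
    · simp only [c, dif_pos hv, mem_insert, mem_erase] at h1
      exact ⟨h1.resolve_right fun h => h2 h.2, hv⟩
    · simp only [c, dif_neg hv] at h1
      exact absurd h1 h2
  refine ⟨c, fun v => ?_, fun f hf γ' => ?_⟩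
  · by_cases hv : ∃ γ, B v γ
    · obtain ⟨e, he, hve, -, h2⟩ := hv.choose_spec
      have h3 := h2 v hve
      have h4 : 0 < (ω v).1.1.card := card_pos.2 ⟨_, h3⟩
      have h5 := (hst v).1
      simp only [c, dif_pos hv]
      rw [card_insert_of_notMem fun h => (hst v).2.1 (mem_of_mem_erase h), card_erase_of_mem h3]
      omega
    · simp only [c, dif_neg hv]
      exact (hst v).1
  by_contra! hfc
  by_cases hmono : ∀ w ∈ f, γ' ∈ (ω w).1.1
  · obtain ⟨v, hvf, hvmin⟩ := exists_min_image f R (hE f hf)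
    have hv : ∃ γ, B v γ := ⟨γ', f, hf, hvf, hvmin, hmono⟩
    have h1 := hfc v hvf
    simp only [c, dif_pos hv, mem_insert, mem_erase] at h1
    -- `γ'` survived at `v`, so the color given up there is another one, and its edge serves as `e`.
    have h2 : γ' ≠ hv.choose := (h1.resolve_left fun h => (hst v).2.1 (h ▸ hmono v hvf)).1
    obtain ⟨e, he, hve, h3, h4⟩ := hv.choose_spec
    obtain ⟨w, hw⟩ := h e he f hf v (mem_inter.2 ⟨hve, hvf⟩) _ _ h2.symm _ (hst v).2.2
    refine hw (mem_filter.2 ⟨hω w, ?_⟩)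
    split_ifs with hwv
    · subst hwv
      exact ⟨⟨h4 w hve, Or.inl (hmono w hvf)⟩, rfl⟩
    · exact ⟨fun h => ⟨h4 w h, hR (h3 w h)⟩, fun h => Or.inl (hmono w h), fun _ h => hmono w h⟩
  · push Not at hmono
    -- Every vertex of `f` initially lacking `γ'` gained it as its substitute; take the last of
    -- them.
    obtain ⟨v, hv, hvmax⟩ := exists_max_image (f.filter fun w => γ' ∉ (ω w).1.1) R
      (by obtain ⟨w, h1, h2⟩ := hmono; exact ⟨w, mem_filter.2 ⟨h1, h2⟩⟩)
    obtain ⟨hvf, hvγ⟩ := mem_filter.1 hv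
    obtain ⟨hs, γ, e, he, hve, h3, h4⟩ := hc v γ' (hfc v hvf) hvγ
    have hγ : γ ≠ γ' := fun h => hvγ (h ▸ h4 v hve)
    obtain ⟨w, hw⟩ := h e he f hf v (mem_inter.2 ⟨hve, hvf⟩) _ _ hγ _ (hst v).2.2
    refine hw (mem_filter.2 ⟨hω w, ?_⟩)
    split_ifs with hwv
    · subst hwv
      exact ⟨⟨h4 w hve, Or.inr hs.symm⟩, rfl⟩
    · refine ⟨fun h => ⟨h4 w h, hR (h3 w h)⟩, fun h => ?_, fun h1 h2 => ?_⟩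
      · by_cases hm : γ' ∈ (ω w).1.1
        · exact Or.inl hm
        · exact Or.inr ⟨(hc w γ' (hfc w h) hm).1.symm, hR (hvmax w (mem_filter.2 ⟨h, hm⟩))⟩
      -- Such a `w` would come both no earlier than `v` (first in `e`) and no later (last recolored
      -- in `f`).
      · by_contra hm
        exact hwv (hRinj (h3 w h1) (hvmax w (mem_filter.2 ⟨h2, hm⟩)))

/-! ### Conflict products and the analytic estimates -/

lemma prod_card_conflictStates_le {V : Type*} [Fintype V] [DecidableEq V] {a b N n : ℕ}
    {e f : Finset V} {v : V} {γ γ' : Fin a} {t : ℕ} (hb2 : 2 ≤ b) (hb : b + 1 ≤ a) (hγ : γ ≠ γ')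
    (ht : t < N) (he : e.card = n) (hf : f.card = n) (hv : v ∈ e ∩ f) :
    (∏ w, ((conflictStates a b N e f v γ γ' t w).card : ℝ))
      ≤ (vertexStates a b N).card ^ Fintype.card V * (b ^ 2 / (a * (a - 1)) / N *
        ((b / a) ^ (2 * (n - 1)) *
        ((1 - t / N) * (1 + (t + 1) / (N * b))) ^ (n - 1) *
        ((b - 1) * a / (b * (a - 1))) ^ ((e ∩ f).card - 1))) := by
  obtain ⟨hve, hvf⟩ := mem_inter.1 hv
  have key : ∀ (s : Finset V) (x : ℝ), v ∈ s →
      ∏ w ∈ univ.erase v, (if w ∈ s then x else 1) = x ^ (s.card - 1) := fun s x hs => by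
    rw [prod_ite_mem, prod_const, ← card_erase_of_mem hs]
    congr 2
    ext w
    simp
  have hN : (0 : ℝ) < N := by exact_mod_cast (by omega : 0 < N)
  have ha0 : (b : ℝ) + 1 ≤ a := by exact_mod_cast hb
  have hV : Fintype.card V = (Fintype.card V - 1) + 1 :=
    (Nat.succ_pred_eq_of_pos (Fintype.card_pos_iff.2 ⟨v⟩)).symm
  rw [← mul_prod_erase univ _ (mem_univ v)]
  calc _ ≤ ((vertexStates a b N).card * (b ^ 2 / (a * (a - 1)) / N) : ℝ) *
        ∏ w ∈ univ.erase v, ((vertexStates a b N).card : ℝ) *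
        ((if w ∈ e then (b / a : ℝ) * (1 - t / N) else 1) *
        (if w ∈ f then (b / a : ℝ) * (1 + (t + 1) / (N * b)) else 1) *
        (if w ∈ e ∩ f then (b - 1) * a / (b * (a - 1) : ℝ) else 1)) := by
        refine mul_le_mul (card_conflictStates_self hb hγ ht)
          (prod_le_prod (fun _ _ => Nat.cast_nonneg _)
            fun w hw => card_conflictStates_of_ne hb2 hb hγ ht (ne_of_mem_erase hw))
          (prod_nonneg fun _ _ => Nat.cast_nonneg _) ?_
        have : (0 : ℝ) ≤ a - 1 := by linarith [(Nat.cast_nonneg b : (0 : ℝ) ≤ b)]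
        positivity
    _ = _ := by
        rw [prod_mul_distrib, prod_mul_distrib, prod_mul_distrib, key e _ hve, key f _ hvf,
          key _ _ hv, prod_const, card_erase_of_mem (mem_univ v), card_univ, he, hf, hV,
          Nat.add_sub_cancel, pow_succ, two_mul, pow_add, mul_pow, mul_pow, mul_pow]
        ring

/-- Since `b ≥ 2`, the base is at most `1 + 1/N - (t+1)/(2N)`, linear in `t`; its power is dominated
by a difference of consecutive `n`-th powers, and the sum telescopes. -/
lemma sum_weight_pow_le {b n N : ℕ} (hb : 2 ≤ b) (hn : 1 ≤ n) (hN : 1 ≤ N) :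
    ∑ t ∈ range N, ((1 - t / N : ℝ) * (1 + (t + 1) / (N * b))) ^ (n - 1)
      ≤ 2 * N / n * (1 + 1 / N) ^ n := by
  obtain ⟨m, rfl⟩ : ∃ m, n = m + 1 := ⟨n - 1, by omega⟩
  have hN0 : (1 : ℝ) ≤ N := by exact_mod_cast hN
  have hb0 : (2 : ℝ) ≤ b := by exact_mod_cast hb
  let h : ℕ → ℝ := fun t => (1 + 1 / N - t / (2 * N)) ^ (m + 1)
  have hstep : ∀ t ∈ range N, ((1 - t / N : ℝ) * (1 + (t + 1) / (N * b))) ^ (m + 1 - 1)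
      ≤ 2 * N / (m + 1 : ℕ) * (h t - h (t + 1)) := fun t ht => by
    have htN : (t : ℝ) + 1 ≤ N := by exact_mod_cast mem_range.1 ht
    have hu : (t : ℝ) / N ≤ 1 := (div_le_one (by linarith)).2 (by linarith)
    have hx : (1 - t / N : ℝ) * (1 + (t + 1) / (N * b)) ≤ 1 + 1 / N - (t + 1 : ℕ) / (2 * N) := by
      calc _ ≤ (1 - t / N : ℝ) * (1 + (t + 1) / (N * 2)) := by
            refine mul_le_mul_of_nonneg_left ?_ (by linarith)
            gcongr
        _ = 1 + 1 / N - (t + 1 : ℕ) / (2 * N) - (t / N) * ((t + 1) / (N * 2)) := by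
            push_cast
            field_simp
            ring
        _ ≤ _ := by
            have : (0 : ℝ) ≤ (t / N) * ((t + 1) / (N * 2)) := by positivity
            linarith
    have h0 : (0 : ℝ) ≤ (1 - t / N : ℝ) * (1 + (t + 1) / (N * b)) :=
      mul_nonneg (by linarith) (by positivity)
    have h1 := pow_add_mul_le_add_pow (h0.trans hx) 
      (by have : (0 : ℝ) ≤ 1 / (2 * N) := by positivity
          linarith [h0.trans hx] : (0 : ℝ) ≤ 2 * _ + 1 / (2 * N)) (m + 1)
    have h2 : (1 + 1 / N - (t + 1 : ℕ) / (2 * N) + 1 / (2 * N) : ℝ) = 1 + 1 / N - t / (2 * N) := by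
      push_cast
      ring
    rw [h2, Nat.add_sub_cancel] at h1
    rw [Nat.add_sub_cancel]
    calc _ ≤ (1 + 1 / N - (t + 1 : ℕ) / (2 * N) : ℝ) ^ m := pow_le_pow_left₀ h0 hx m
      _ = 2 * N / (m + 1 : ℕ) *
          ((m + 1 : ℕ) * (1 + 1 / N - (t + 1 : ℕ) / (2 * N) : ℝ) ^ m * (1 / (2 * N))) := by
          push_cast
          field_simp
      _ ≤ _ := by
          refine mul_le_mul_of_nonneg_left ?_ (by positivity)
          simp only [h]
          linarith
  refine (sum_le_sum hstep).trans ?_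
  rw [← mul_sum, sum_range_sub']
  refine mul_le_mul_of_nonneg_left ?_ (by positivity)
  have h1 : 0 ≤ h N := by
    have : (1 + 1 / N - N / (2 * N) : ℝ) = 1 / 2 + 1 / N := by
      field_simp
      ring
    simp only [h, this]
    positivity
  have h2 : h 0 = (1 + 1 / N) ^ (m + 1) := by simp [h]
  linarith

lemma mul_pow_pred_le {r : ℝ} (h0 : 0 ≤ r) (h1 : r < 1) (j : ℕ) :
    j * r ^ (j - 1) ≤ 1 / (1 - r) := by
  rw [le_div_iff₀ (by linarith)]
  have h2 : (j : ℝ) * r ^ (j - 1) ≤ ∑ i ∈ range j, r ^ i := by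
    rw [← nsmul_eq_mul]
    refine le_of_eq_of_le (by rw [card_range]) (card_nsmul_le_sum (range j) _ _ fun i hi =>
      pow_le_pow_of_le_one h0 h1.le (by have := mem_range.1 hi; omega : i ≤ j - 1))
  refine (mul_le_mul_of_nonneg_right h2 (by linarith)).trans ?_
  rw [geom_sum_mul_neg]
  linarith [pow_nonneg h0 j]

/-- Bernoulli gives `(1-x)^n ≥ 3/4` for `x = 1/(4n)`, while `(1+x)^n (1-x)^n ≤ 1`. -/
lemma one_add_pow_four_mul_le {n : ℕ} (hn : 1 ≤ n) :
    (1 + 1 / (4 * n : ℕ) : ℝ) ^ n ≤ 4 / 3 := by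
  have hn0 : (1 : ℝ) ≤ n := by exact_mod_cast hn
  have hx : (1 / (4 * n : ℕ) : ℝ) ≤ 1 := by
    push_cast
    rw [div_le_one (by linarith)]
    linarith
  have hx0 : (0 : ℝ) ≤ 1 / (4 * n : ℕ) := by positivity
  have h1 := one_add_mul_le_pow (a := -(1 / (4 * n : ℕ) : ℝ)) (by linarith) n
  have h2 : 1 + n * -(1 / (4 * n : ℕ) : ℝ) = 3 / 4 := by
    push_cast
    field_simp
    norm_num
  have h3 : ((1 + 1 / (4 * n : ℕ) : ℝ) * (1 + -(1 / (4 * n : ℕ)))) ^ n ≤ 1 :=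
    pow_le_one₀ (mul_nonneg (by linarith) (by linarith)) (by nlinarith)
  rw [mul_pow] at h3
  rw [h2] at h1
  have h4 : (0 : ℝ) ≤ (1 + 1 / (4 * n : ℕ) : ℝ) ^ n := by positivity
  nlinarith [mul_le_mul_of_nonneg_left h1 h4]

/-! ### The union bound -/

lemma exists_states_of_sum_lt {V : Type*} [Fintype V] [DecidableEq V] {a b N : ℕ}
    {E : Finset (Finset V)}
    (h : ∑ e ∈ E, ∑ f ∈ E, ∑ v ∈ e ∩ f, ∑ g ∈ (univ : Finset (Fin a)).offDiag, ∑ t ∈ range N,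
      ∏ w, (conflictStates a b N e f v g.1 g.2 t w).card
        < (vertexStates a b N).card ^ Fintype.card V) :
    ∃ ω : V → (Finset (Fin a) × Fin a) × ℕ, (∀ v, ω v ∈ vertexStates a b N) ∧
      ∀ e ∈ E, ∀ f ∈ E, ∀ v ∈ e ∩ f, ∀ γ γ', γ ≠ γ' → ∀ t < N,
        ∃ w, ω w ∉ conflictStates a b N e f v γ γ' t w := by
  by_contra! hcon
  refine h.not_ge ?_
  have hsub : Fintype.piFinset (fun _ : V => vertexStates a b N) ⊆
      E.biUnion fun e => E.biUnion fun f => (e ∩ f).biUnion fun v =>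
        (univ : Finset (Fin a)).offDiag.biUnion fun g => (range N).biUnion fun t =>
          Fintype.piFinset fun w => conflictStates a b N e f v g.1 g.2 t w := fun ω hω => by
    obtain ⟨e, he, f, hf, v, hv, γ, γ', hγ, t, ht, hw⟩ := hcon ω (Fintype.mem_piFinset.1 hω)
    simp only [mem_biUnion]
    exact ⟨e, he, f, hf, v, hv, (γ, γ'), mem_offDiag.2 ⟨mem_univ _, mem_univ _, hγ⟩, t,
      mem_range.2 ht, Fintype.mem_piFinset.2 hw⟩
  have hcard := card_le_card hsub
  rw [Fintype.card_piFinset, prod_const, card_univ] at hcard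
  refine hcard.trans ?_
  refine card_biUnion_le.trans (sum_le_sum fun e _ => ?_)
  refine card_biUnion_le.trans (sum_le_sum fun f _ => ?_)
  refine card_biUnion_le.trans (sum_le_sum fun v _ => ?_)
  refine card_biUnion_le.trans (sum_le_sum fun g _ => ?_)
  refine card_biUnion_le.trans (sum_le_sum fun t _ => ?_)
  rw [Fintype.card_piFinset]

lemma sum_conflict_le {V : Type*} [Fintype V] [DecidableEq V] {a b n : ℕ} (hb : 2 ≤ b)
    (hab : b + 2 ≤ a) (hn : 1 ≤ n) {e f : Finset V} (he : e.card = n) (hf : f.card = n) :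
    ∑ v ∈ e ∩ f, ∑ g ∈ (univ : Finset (Fin a)).offDiag, ∑ t ∈ range (4 * n),
        ∏ w, ((conflictStates a b (4 * n) e f v g.1 g.2 t w).card : ℝ)
      ≤ (vertexStates a b (4 * n)).card ^ Fintype.card V * ((b / a) ^ (2 * (n - 1)) *
        (b ^ 3 * (a - 1) / (a - b) * (8 / (3 * n)))) := by
  have hb0 : (2 : ℝ) ≤ b := by exact_mod_cast hb
  have ha0 : (b : ℝ) + 2 ≤ a := by exact_mod_cast hab
  have hn0 : (1 : ℝ) ≤ n := by exact_mod_cast hn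
  have ha1 : (0 : ℝ) < a - 1 := by linarith
  have hba : (0 : ℝ) < a - b := by linarith
  have hb1 : (0 : ℝ) ≤ b - 1 := by linarith
  set Z : ℝ := (vertexStates a b (4 * n)).card ^ Fintype.card V
  have hZ : 0 ≤ Z := by positivity
  set r : ℝ := (b - 1) * a / (b * (a - 1)) with hr
  have hr0 : 0 ≤ r := div_nonneg (mul_nonneg hb1 (by linarith)) (by positivity)
  -- So the sum over `v ∈ e ∩ f` costs at most `b(a-1)/(a-b)`, whatever the size of the
  -- intersection.
  have hr1 : 1 - r = (a - b) / (b * (a - 1)) := by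
    rw [hr]
    field_simp
    ring
  have hr2 : r < 1 := by
    have : 0 < (a - b : ℝ) / (b * (a - 1)) := by positivity
    linarith
  have hoff : ((univ : Finset (Fin a)).offDiag.card : ℝ) = a * (a - 1) := by
    rw [offDiag_card, card_univ, Fintype.card_fin, Nat.cast_sub (Nat.le_mul_self a)]
    push_cast
    ring
  have hS := (sum_weight_pow_le (N := 4 * n) hb hn (by omega)).trans
    (mul_le_mul_of_nonneg_left (one_add_pow_four_mul_le hn) (by positivity))
  set S : ℝ := ∑ t ∈ range (4 * n),
    ((1 - t / (4 * n : ℕ) : ℝ) * (1 + (t + 1) / ((4 * n : ℕ) * b))) ^ (n - 1)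
  have hj := mul_pow_pred_le hr0 hr2 (e ∩ f).card
  rw [hr1, one_div_div] at hj
  set K : ℝ := b ^ 2 / (a * (a - 1)) / (4 * n : ℕ)
  have hK : 0 ≤ K := by positivity
  calc _ ≤ ∑ v ∈ e ∩ f, ∑ g ∈ (univ : Finset (Fin a)).offDiag, ∑ t ∈ range (4 * n),
        Z * (K * ((b / a) ^ (2 * (n - 1)) *
        ((1 - t / (4 * n : ℕ) : ℝ) * (1 + (t + 1) / ((4 * n : ℕ) * b))) ^ (n - 1) *
          r ^ ((e ∩ f).card - 1))) := by
        refine sum_le_sum fun v hv => sum_le_sum fun g hg => sum_le_sum fun t ht => ?_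
        exact prod_card_conflictStates_le hb (by omega) (mem_offDiag.1 hg).2.2
          (mem_range.1 ht) he hf hv
    _ = Z * ((b / a) ^ (2 * (n - 1)) * (a * (a - 1) * K * S *
          ((e ∩ f).card * r ^ ((e ∩ f).card - 1)))) := by
        simp only [← mul_sum, ← sum_mul, sum_const, nsmul_eq_mul, hoff]
        simp only [S]
        ring
    _ ≤ Z * ((b / a) ^ (2 * (n - 1)) * (a * (a - 1) * K *
          (2 * (4 * n : ℕ) / n * (4 / 3)) * (b * (a - 1) / (a - b)))) := by
        gcongr
    _ = _ := by
        simp only [K]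
        have ha2 : (a : ℝ) ≠ 0 := by linarith
        push_cast
        field_simp
        ring

theorem exists_coloring_of_card_le {V : Type*} [Fintype V] [LinearOrder V] {a b n : ℕ}
    (hb : 2 ≤ b) (hab : b + 2 ≤ a) (hn : 1 ≤ n) (hlog : 4 / 3 < Real.log n)
    {E : Finset (Finset V)} (hE : ∀ e ∈ E, e.card = n)
    (hcard : (E.card : ℝ) ^ 2 * (b / a) ^ (2 * (n - 1)) * (a * b ^ 3 * Real.log n) ≤ n) :
    ∃ c : V → Finset (Fin a), (∀ v, (c v).card = b) ∧ ∀ e ∈ E, ∀ γ, ∃ v ∈ e, γ ∉ c v := by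
  have hb0 : (2 : ℝ) ≤ b := by exact_mod_cast hb
  have ha0 : (b : ℝ) + 2 ≤ a := by exact_mod_cast hab
  have hn0 : (1 : ℝ) ≤ n := by exact_mod_cast hn
  have hZ : 0 < (vertexStates a b (4 * n)).card ^ Fintype.card V := by
    have h1 := Nat.choose_pos (n := a) (k := b) (by omega)
    have h2 : 0 < a - b := by omega
    rw [card_vertexStates, card_colorPairs]
    positivity
  obtain ⟨ω, hω, h⟩ := exists_states_of_sum_lt (a := a) (b := b) (N := 4 * n) (E := E) (by
    rw [← Nat.cast_lt (α := ℝ)]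
    push_cast
    have hZ' : (0 : ℝ) < (vertexStates a b (4 * n)).card ^ Fintype.card V := by exact_mod_cast hZ
    calc _ ≤ ∑ e ∈ E, ∑ f ∈ E, _ := sum_le_sum fun e he => sum_le_sum fun f hf =>
          sum_conflict_le hb hab hn (hE e he) (hE f hf)
      _ = ((vertexStates a b (4 * n)).card ^ Fintype.card V : ℝ) *
          ((E.card : ℝ) ^ 2 * (b / a) ^ (2 * (n - 1)) * b ^ 3 *
            ((a - 1) / (a - b) * (8 / (3 * n)))) := by
          rw [sum_const, sum_const, nsmul_eq_mul, nsmul_eq_mul]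
          ring
      _ < ((vertexStates a b (4 * n)).card ^ Fintype.card V : ℝ) * 1 := by
          refine mul_lt_mul_of_pos_left ?_ hZ'
          set X : ℝ := (E.card : ℝ) ^ 2 * (b / a) ^ (2 * (n - 1)) * b ^ 3 with hX
          have hX0 : 0 ≤ X := by positivity
          have h1 : X * (a * Real.log n) ≤ n := by
            rw [hX]
            linarith
          -- This is where `a - b ≥ 2` enters.
          have h2 : (a - 1 : ℝ) / (a - b) ≤ a / 2 := by
            rw [div_le_div_iff₀ (by linarith) (by norm_num)]
            nlinarith
          have h3 : X * a * (4 / 3) < n := by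
            rcases hX0.eq_or_lt with h | h
            · rw [← h]
              linarith
            · have : X * a * (4 / 3) < X * a * Real.log n :=
                mul_lt_mul_of_pos_left hlog (mul_pos h (by linarith))
              linarith
          calc _ ≤ X * (a / 2 * (8 / (3 * n))) := by gcongr
            _ = X * a * (4 / 3) / n := by
                field_simp
                ring
            _ < 1 := (div_lt_one (by linarith)).2 h3
      _ = _ := mul_one _)
  exact exists_coloring_of_no_conflict (fun e he => card_pos.1 (by rw [hE e he]; omega)) hω h

/-! ### Small `n` and the passage to arbitrary hypergraphs -/

lemma four_thirds_lt_log {n : ℕ} (hn : 4 ≤ n) : 4 / 3 < Real.log n := by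
  have h1 : Real.log 4 ≤ Real.log n := Real.log_le_log (by norm_num) (by exact_mod_cast hn)
  have h2 : Real.log 4 = 2 * Real.log 2 := by
    rw [show (4 : ℝ) = 2 ^ 2 by norm_num, Real.log_pow]
    norm_num
  have := Real.log_two_gt_d9
  linarith

lemma four_le_of_two_le_div_log {n : ℕ} (hn : 2 ≤ n)
    (h : (2 : ℝ) ≤ (n : ℝ) / (2 * Real.log n)) : 4 ≤ n := by
  by_contra! hlt
  have hl2 := Real.log_two_gt_d9
  interval_cases n
  · rw [le_div_iff₀ (by push_cast; linarith)] at h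
    push_cast at h
    linarith
  · have : Real.log 3 > 1 := by
      rw [gt_iff_lt, Real.lt_log_iff_exp_lt (by norm_num)]
      linarith [Real.exp_one_lt_d9]
    rw [le_div_iff₀ (by push_cast; linarith)] at h
    push_cast at h
    linarith

theorem theorem1 {α : Type*} (a b n : ℕ) (hn : 2 ≤ n) (hb : 2 ≤ b) (hab : b + 2 ≤ a)
    (han : (a : ℝ) - 2 ≤ (n : ℝ) / (2 * Real.log n))
    (H : Hypergraph α) (hunif : H.IsUniform n) (hfin : H.edgeSet.Finite)
    (hcard : (H.edgeSet.ncard : ℝ) ≤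
      ((a : ℝ) * (b : ℝ) ^ 3) ^ (-(1 / 2) : ℝ) * ((n : ℝ) / Real.log n) ^ (1 / 2 : ℝ) *
        ((a : ℝ) / (b : ℝ)) ^ (n - 1)) :
    H.FractionallyColorable a b := by
  classical
  have hb0 : (2 : ℝ) ≤ b := by exact_mod_cast hb
  have ha0 : (b : ℝ) + 2 ≤ a := by exact_mod_cast hab
  have ha1 : (a : ℝ) ≠ 0 := by linarith
  -- `a - 2 ≥ b ≥ 2`, so the upper bound on `a` rules out `n = 2, 3`.
  have hn4 : 4 ≤ n := four_le_of_two_le_div_log hn (by linarith)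
  have hlog := four_thirds_lt_log hn4
  have hlog0 : 0 < Real.log n := by linarith
  have hfine : ∀ e ∈ H.edgeSet, e.Finite := fun e he =>
    Set.finite_of_encard_eq_coe (hunif e he)
  -- Only the finitely many vertices lying on edges matter; the others later receive a fixed `b`-set
  -- `C₀`.
  let S : Finset α := (hfin.sUnion hfine).toFinset
  have hS : ∀ e ∈ H.edgeSet, ∀ v ∈ e, v ∈ S := fun e he v hv =>
    (Set.Finite.mem_toFinset _).2 ⟨e, he, hv⟩
  let φ : Set α → Finset S := fun e => univ.filter fun v => v.1 ∈ e
  let _ : LinearOrder S := linearOrderOfSTO WellOrderingRel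
  have hE : ∀ e ∈ hfin.toFinset.image φ, e.card = n := fun e' h => by
    obtain ⟨e, he, rfl⟩ := mem_image.1 h
    have he' := (Set.Finite.mem_toFinset _).1 he
    have h1 : ((φ e).map (Function.Embedding.subtype _) : Set α) = e := by
      ext v
      simp only [φ, coe_map, Set.mem_image, mem_coe, mem_filter, mem_univ, true_and,
        Function.Embedding.subtype_apply]
      exact ⟨fun ⟨w, hw, h⟩ => h ▸ hw, fun hv => ⟨⟨v, hS e he' v hv⟩, hv, rfl⟩⟩
    have h2 := hunif e he'
    rw [← h1, Set.encard_coe_eq_coe_finsetCard, card_map] at h2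
    exact_mod_cast h2
  have hM : ((hfin.toFinset.image φ).card : ℝ) ≤ H.edgeSet.ncard := by
    rw [Set.ncard_eq_toFinset_card _ hfin]
    exact_mod_cast card_image_le
  have hsq := pow_le_pow_left₀ (Nat.cast_nonneg _) (hM.trans hcard) 2
  have hbound : ((hfin.toFinset.image φ).card : ℝ) ^ 2 * (b / a) ^ (2 * (n - 1)) *
      (a * b ^ 3 * Real.log n) ≤ n := by
    have h1 : (((a : ℝ) * b ^ 3) ^ (-(1 / 2) : ℝ)) ^ 2 = ((a : ℝ) * b ^ 3)⁻¹ := by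
      rw [← Real.rpow_natCast, ← Real.rpow_mul (by positivity)]
      norm_num [Real.rpow_neg_one]
    have h2 : (((n : ℝ) / Real.log n) ^ (1 / 2 : ℝ)) ^ 2 = n / Real.log n := by
      rw [← Real.rpow_natCast, ← Real.rpow_mul (by positivity)]
      norm_num
    rw [mul_pow, mul_pow, h1, h2, ← pow_mul, mul_comm (n - 1) 2] at hsq
    have h3 : ((a : ℝ) / b) ^ (2 * (n - 1)) * (b / a) ^ (2 * (n - 1)) = 1 := by
      rw [← mul_pow, div_mul_div_cancel₀ (by positivity), div_self ha1, one_pow]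
    calc _ ≤ ((a : ℝ) * b ^ 3)⁻¹ * (n / Real.log n) * (a / b) ^ (2 * (n - 1)) *
          (b / a) ^ (2 * (n - 1)) * (a * b ^ 3 * Real.log n) := by gcongr
      _ = ((a : ℝ) * b ^ 3)⁻¹ * (n / Real.log n) * (a * b ^ 3 * Real.log n) := by
          rw [mul_assoc _ (((a : ℝ) / b) ^ _), h3, mul_one]
      _ = n := by field_simp
  obtain ⟨c, hc, hce⟩ := exists_coloring_of_card_le hb hab (by omega) hlog hE hbound
  obtain ⟨C₀, -, hC₀⟩ := exists_subset_card_eq (s := (univ : Finset (Fin a))) (n := b)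
    (by rw [card_univ, Fintype.card_fin]; omega)
  refine ⟨fun v => if hv : v ∈ S then c ⟨v, hv⟩ else C₀, fun v _ => ?_, fun e he => ?_⟩
  · dsimp only
    split_ifs
    · exact hc _
    · exact hC₀
  · rintro ⟨γ, hγ⟩
    obtain ⟨v, hv, hvγ⟩ := hce (φ e) (mem_image_of_mem _ ((Set.Finite.mem_toFinset _).2 he)) γ
    refine hvγ ?_
    have h := hγ v.1 (mem_filter.1 hv).2
    dsimp only at h
    rwa [dif_pos v.2] at h
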